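/- Let $\mathcal H$ be a separable complex Hilbert space, and let $H$ be a (possibly unbounded, possibly continuous-spectrum) self-adjoint operator on $\mathcal H$ which is not the zero operator. Let $T:\mathcal H\to\mathcal H$ be an antiunitary bijection (an antilinear isometric bijection) such that $T^2=-I$ and such that $T$ commutes with $H$, that is, $T$ maps the domain $D(H)$ into itself and $HT\psi=TH\psi$ for all $\psi\in D(H)$. Let $\{H\}'$ be the commutant of $H$: the set of all bounded linear operators $B$ on $\mathcal H$ commuting with $H$, i.e. with $B\,D(H)\subseteq D(H)$ and $HB\psi=BH\psi$ for all $\psi\in D(H)$. Let $\{H\}''$ be the double commutant of $H$: the set of all closed densely defined linear operators $C$ on $\mathcal H$ that commute with every $B\in\{H\}'$, i.e. with $B\,D(C)\subseteq D(C)$ and $CB\psi=BC\psi$ for all $\psi\in D(C)$. Then $$\{H\}'\neq\{H\}''.$$ Moreover, the two sets already differ among bounded operators: if $\mathcal B(\mathcal H)$ denotes the bounded linear operators on $\mathcal H$, then $$\{H\}'\neq\{H\}''\cap\mathcal B(\mathcal H).$$ -/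

import Mathlib

namespace Kramers

variable {E : Type*} [NormedAddCommGroup E] [InnerProductSpace ℂ E]

/-- An everywhere defined map `S` (linear or antilinear) commutes with the possibly unbounded
operator `A`, i.e. `S A ⊆ A S`: `S` maps the domain of `A` into itself, and there
`A (S x) = S (A x)`. -/
def CommutesWith (S : E → E) (A : E →ₗ.[ℂ] E) : Prop :=
  ∀ x : A.domain, ∃ h : S x ∈ A.domain, A ⟨S x, h⟩ = S (A x)

/-- The commutant of `A`: all bounded (everywhere defined) linear operators commuting
with `A`. -/
def commutant (A : E →ₗ.[ℂ] E) : Set (E →L[ℂ] E) :=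
  {B | CommutesWith B A}

/-- A bounded operator, regarded as a partially defined operator whose domain is the whole
space. -/
def ofBounded (B : E →L[ℂ] E) : E →ₗ.[ℂ] E :=
  (B : E →ₗ[ℂ] E).toPMap ⊤

/-- The double commutant of `A`: all closed (densely defined, possibly unbounded) linear
operators commuting with every element of the commutant of `A`. -/
def doubleCommutant (A : E →ₗ.[ℂ] E) : Set (E →ₗ.[ℂ] E) :=
  {C | Dense (C.domain : Set E) ∧ C.IsClosed ∧ ∀ B ∈ commutant A, CommutesWith B C}

/-- The bounded double commutant of `A`: the bounded operators which belong to the double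
commutant of `A`. -/
def boundedDoubleCommutant (A : E →ₗ.[ℂ] E) : Set (E →L[ℂ] E) :=
  {C | ofBounded C ∈ doubleCommutant A}

end Kramers

namespace Kramers

open ComplexConjugate

variable {E : Type*} [NormedAddCommGroup E] [InnerProductSpace ℂ E]

/-- An antiunitary map conjugates inner products. -/
theorem antiunitary_inner_map_map (T : E ≃ₗᵢ⋆[ℂ] E) (x y : E) :
    inner ℂ (T x) (T y) = inner ℂ y x := by
  have key (u v : E) : ‖u - Complex.I • v‖ = ‖v + Complex.I • u‖ := by
    have : v + Complex.I • u = Complex.I • (u - Complex.I • v) := by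
      rw [smul_sub, smul_smul, Complex.I_mul_I]; module
    rw [this, norm_smul, Complex.norm_I, one_mul]
  have hadd (u v : E) : ‖T u + T v‖ = ‖u + v‖ := by rw [← map_add, T.norm_map]
  have hsub (u v : E) : ‖T u - T v‖ = ‖u - v‖ := by rw [← map_sub, T.norm_map]
  have hI (u v : E) : ‖T u + Complex.I • T v‖ = ‖u - Complex.I • v‖ := by
    rw [← T.norm_map (u - _), map_sub, T.map_smulₛₗ, starRingEnd_apply, Complex.star_def,
      Complex.conj_I, neg_smul, sub_neg_eq_add]
  have hI' : ‖T x - Complex.I • T y‖ = ‖y - Complex.I • x‖ := by rw [key, hI]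
  rw [inner_eq_sum_norm_sq_div_four, inner_eq_sum_norm_sq_div_four (𝕜 := ℂ) y x]
  simp only [RCLike.I_to_complex]
  rw [hadd, hsub, hI, hI', add_comm y x, norm_sub_rev y x, key x y]

theorem apply_comm_of_mem_boundedDoubleCommutant {A : E →ₗ.[ℂ] E} {B C : E →L[ℂ] E}
    (hB : B ∈ commutant A) (hC : C ∈ boundedDoubleCommutant A) (x : E) : C (B x) = B (C x) :=
  (hC.2.2 B hB ⟨x, trivial⟩).2

section Projection

variable [CompleteSpace E]

/-- The projection onto a subspace invariant under `A` and `A†` commutes with `A`. -/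
theorem starProjection_apply_comm_of_invariant (K : Submodule ℂ E) [K.HasOrthogonalProjection]
    (A : E →L[ℂ] E) (h : ∀ x ∈ K, A x ∈ K) (h' : ∀ x ∈ K, star A x ∈ K) (x : E) :
    K.starProjection (A x) = A (K.starProjection x) := by
  refine Submodule.eq_starProjection_of_mem_of_inner_eq_zero
    (h _ (K.starProjection_apply_mem x)) ?_
  intro w hw
  rw [← map_sub, ← ContinuousLinearMap.adjoint_inner_right]
  exact K.starProjection_inner_eq_zero x _ (h' w hw)

/-- The closed cyclic subspace generated by a vector under a `*`-algebra of operators. -/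
noncomputable def cyclicSubspace (S : StarSubalgebra ℂ (E →L[ℂ] E)) (v : E) : Submodule ℂ E :=
  (S.toSubalgebra.toSubmodule.map (ContinuousLinearMap.apply ℂ E v).toLinearMap).topologicalClosure

noncomputable instance (S : StarSubalgebra ℂ (E →L[ℂ] E)) (v : E) :
    CompleteSpace (cyclicSubspace S v) :=
  (Submodule.isClosed_topologicalClosure _).completeSpace_coe

theorem apply_mem_cyclicSubspace (S : StarSubalgebra ℂ (E →L[ℂ] E)) (v : E) {B : E →L[ℂ] E}
    (hB : B ∈ S) : B v ∈ cyclicSubspace S v :=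
  Submodule.le_topologicalClosure _ ⟨B, hB, rfl⟩

theorem self_mem_cyclicSubspace (S : StarSubalgebra ℂ (E →L[ℂ] E)) (v : E) :
    v ∈ cyclicSubspace S v := by
  simpa using apply_mem_cyclicSubspace S v (one_mem S)

theorem cyclicSubspace_invariant (S : StarSubalgebra ℂ (E →L[ℂ] E)) (v : E) {B : E →L[ℂ] E}
    (hB : B ∈ S) : ∀ x ∈ cyclicSubspace S v, B x ∈ cyclicSubspace S v := by
  intro x hx
  refine map_mem_closure B.continuous hx ?_
  rintro _ ⟨A, hA, rfl⟩
  exact ⟨B * A, S.mul_mem hB hA, rfl⟩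

theorem cyclicSubspace_starProjection_comm (S : StarSubalgebra ℂ (E →L[ℂ] E)) (v : E)
    {B : E →L[ℂ] E} (hB : B ∈ S) (x : E) :
    (cyclicSubspace S v).starProjection (B x) = B ((cyclicSubspace S v).starProjection x) :=
  starProjection_apply_comm_of_invariant _ B (cyclicSubspace_invariant S v hB)
    (cyclicSubspace_invariant S v (star_mem hB)) x

theorem cyclicSubspace_starProjection_eq_zero (S : StarSubalgebra ℂ (E →L[ℂ] E)) (v w : E)
    (h : ∀ B ∈ S, inner ℂ (B v) w = 0) : (cyclicSubspace S v).starProjection w = 0 := by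
  suffices w ∈ (cyclicSubspace S v).starProjection.ker from this
  rw [Submodule.ker_starProjection, cyclicSubspace, Submodule.orthogonal_closure]
  rintro _ ⟨B, hB, rfl⟩
  exact h B hB

/-- If an antiunitary `T` with `T² = -1` intertwines every element of a `*`-algebra with its
adjoint, then the projections onto the cyclic subspaces of `v` and `v + T v` do not commute. -/
theorem exists_cyclicSubspace_starProjection_not_comm [Nontrivial E]
    (S : StarSubalgebra ℂ (E →L[ℂ] E)) (T : E ≃ₗᵢ⋆[ℂ] E) (hT : ∀ x, T (T x) = -x)
    (hTS : ∀ B ∈ S, ∀ x, T (B x) = star B (T x)) :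
    ∃ v w x : E, (cyclicSubspace S v).starProjection ((cyclicSubspace S w).starProjection x) ≠
      (cyclicSubspace S w).starProjection ((cyclicSubspace S v).starProjection x) := by
  obtain ⟨v, hv⟩ := exists_ne (0 : E)
  have hTB (B) (hB : B ∈ S) (x : E) : B (T x) = T (star B x) := by
    rw [hTS _ (star_mem hB), star_star]
  have horth (B) (hB : B ∈ S) : inner ℂ (B v) (T v) = 0 := by
    have h : inner ℂ (B v) (T v) = -inner ℂ (B v) (T v) := by
      conv_lhs => rw [← antiunitary_inner_map_map T, hT, hTS B hB, inner_neg_left,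
        ContinuousLinearMap.star_eq_adjoint, ContinuousLinearMap.adjoint_inner_right]
    exact self_eq_neg.mp h
  have horth' (B) (hB : B ∈ S) : inner ℂ (B (T v)) v = 0 := by
    rw [← ContinuousLinearMap.adjoint_inner_right, ← inner_conj_symm]
    exact (map_eq_zero _).mpr (horth _ (star_mem hB))
  have hdiff (B) (hB : B ∈ S) : inner ℂ (B (T v)) (T v) = inner ℂ (B v) v := by
    rw [hTB B hB, antiunitary_inner_map_map, ContinuousLinearMap.star_eq_adjoint,
      ContinuousLinearMap.adjoint_inner_right]
  set P := (cyclicSubspace S v).starProjection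
  set Q := (cyclicSubspace S (v + T v)).starProjection
  have hPv : P v = v := Submodule.starProjection_eq_self_iff.mpr (self_mem_cyclicSubspace S v)
  have hPT : P (T v) = 0 := cyclicSubspace_starProjection_eq_zero S v (T v) horth
  have hQ : Q (v + T v) = v + T v :=
    Submodule.starProjection_eq_self_iff.mpr (self_mem_cyclicSubspace S _)
  have hQ' : Q (v - T v) = 0 := by
    refine cyclicSubspace_starProjection_eq_zero S _ _ fun B hB => ?_
    rw [map_add, inner_add_left, inner_sub_right, inner_sub_right, horth B hB, horth' B hB,
      hdiff B hB]
    ring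
  refine ⟨v, v + T v, v + T v, fun h => hv ?_⟩
  change P (Q _) = Q (P _) at h
  rw [hQ, map_add, hPv, hPT, add_zero] at h
  have hTv : v = T v := by
    have h2 := hQ'
    rw [map_sub, ← h, sub_eq_zero] at h2
    have h3 := hQ
    rw [map_add, ← h, ← h2] at h3
    exact add_left_cancel h3
  rw [hTv] at hPv
  rw [hTv, ← hPv, hPT]

end Projection

section Resolvent

/-- `R` is an everywhere defined bounded inverse of `A + c`. -/
structure IsShiftInverse (A : E →ₗ.[ℂ] E) (c : ℂ) (R : E →L[ℂ] E) : Prop where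
  mem_domain : ∀ y, R y ∈ A.domain
  apply_right : ∀ y, A ⟨R y, mem_domain y⟩ + c • R y = y
  apply_left : ∀ x : A.domain, R (A x + c • (x : E)) = x

namespace IsShiftInverse

variable {A : E →ₗ.[ℂ] E} {c d : ℂ} {R R' : E →L[ℂ] E}

theorem apply_mk (hR : IsShiftInverse A c R) (y : E) (h : R y ∈ A.domain) :
    A ⟨R y, h⟩ = y - c • R y :=
  eq_sub_of_add_eq (hR.apply_right y)

/-- The first resolvent identity. -/
theorem sub_eq (hR : IsShiftInverse A c R) (hR' : IsShiftInverse A d R') (y : E) :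
    R' y - R y = (c - d) • R (R' y) := by
  have h := hR.apply_left ⟨R' y, hR'.mem_domain y⟩
  rw [hR'.apply_mk] at h
  change _ = R' y at h
  rw [← map_smul, sub_eq_iff_eq_add, ← map_add]
  conv_lhs => rw [← h]
  congr 1
  module

theorem commute (hR : IsShiftInverse A c R) (hR' : IsShiftInverse A d R') : Commute R R' := by
  rcases eq_or_ne c d with rfl | hcd
  · have : R' = R := by
      ext y
      simpa [sub_eq_zero] using hR.sub_eq hR' y
    rw [this]
  · ext y
    have h := hR.sub_eq hR' y
    rw [← neg_sub, hR'.sub_eq hR y, ← neg_smul, neg_sub] at h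
    exact (smul_right_injective E (sub_ne_zero.mpr hcd) h).symm

theorem commutesWith (hR : IsShiftInverse A c R) {B : E →L[ℂ] E} (hB : ∀ x, B (R x) = R (B x)) :
    CommutesWith B A := by
  intro x
  have hx : B x = R (B (A x + c • (x : E))) := by rw [← hB, hR.apply_left]
  have hmem : B x ∈ A.domain := hx ▸ hR.mem_domain _
  refine ⟨hmem, ?_⟩
  have : (⟨B x, hmem⟩ : A.domain) = ⟨R (B (A x + c • (x : E))), hR.mem_domain _⟩ :=
    Subtype.ext hx
  rw [this, hR.apply_mk, ← hx, map_add, map_smul, add_sub_cancel_right]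

/-- An antilinear symmetry of `A` turns `(A + c)⁻¹` into `(A + c̄)⁻¹`. -/
theorem antilinear_apply (hR : IsShiftInverse A c R) (hR' : IsShiftInverse A (conj c) R')
    (T : E ≃ₗᵢ⋆[ℂ] E) (hT : CommutesWith T A) (x : E) : T (R x) = R' (T x) := by
  obtain ⟨h, hA⟩ := hT ⟨R x, hR.mem_domain x⟩
  rw [hR.apply_mk, map_sub, T.map_smulₛₗ] at hA
  have := hR'.apply_left ⟨_, h⟩
  rw [hA, sub_add_cancel] at this
  exact this.symm

variable [CompleteSpace E]

theorem star_eq (hA : A.IsFormalAdjoint A) (hR : IsShiftInverse A c R)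
    (hR' : IsShiftInverse A (conj c) R') : star R = R' := by
  rw [ContinuousLinearMap.star_eq_adjoint, eq_comm, ContinuousLinearMap.eq_adjoint_iff]
  intro x y
  have h := hA ⟨R' x, hR'.mem_domain x⟩ ⟨R y, hR.mem_domain y⟩
  rw [hR'.apply_mk, hR.apply_mk, inner_sub_left, inner_sub_right, inner_smul_left,
    inner_smul_right, Complex.conj_conj, sub_left_inj] at h
  exact h.symm

end IsShiftInverse

theorem norm_sq_add_smul {A : E →ₗ.[ℂ] E} (hA : A.IsFormalAdjoint A) {c : ℂ} (hc : c.re = 0)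
    (hc1 : ‖c‖ = 1) (x : A.domain) :
    ‖A x + c • (x : E)‖ ^ 2 = ‖A x‖ ^ 2 + ‖(x : E)‖ ^ 2 := by
  have him : (inner ℂ (A x) (x : E)).im = 0 := by
    rw [← Complex.conj_eq_iff_im, inner_conj_symm]
    exact (hA x x).symm
  rw [norm_add_sq (𝕜 := ℂ), norm_smul, hc1, one_mul, inner_smul_right]
  simp [hc, him]

variable [CompleteSpace E]

theorem isFormalAdjoint_self {A : E →ₗ.[ℂ] E} (hA : IsSelfAdjoint A) : A.IsFormalAdjoint A := by
  have h := A.adjoint_isFormalAdjoint hA.dense_domain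
  rwa [LinearPMap.isSelfAdjoint_def.mp hA] at h

/-- A self-adjoint operator shifted by an imaginary unit has a bounded inverse. -/
theorem exists_isShiftInverse {A : E →ₗ.[ℂ] E} (hA : IsSelfAdjoint A) {c : ℂ} (hc : c.re = 0)
    (hc1 : ‖c‖ = 1) : ∃ R, IsShiftInverse A c R := by
  have hsym := isFormalAdjoint_self hA
  have : CompleteSpace A.graph := hA.isClosed.completeSpace_coe
  let f : A.graph →L[ℂ] E :=
    (ContinuousLinearMap.snd ℂ E E + c • ContinuousLinearMap.fst ℂ E E).comp A.graph.subtypeL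
  have hf (x : A.domain) : f ⟨(x, A x), A.mem_graph x⟩ = A x + c • (x : E) := rfl
  have hanti : AntilipschitzWith 1 f := by
    refine AddMonoidHomClass.antilipschitz_of_bound f fun p => ?_
    obtain ⟨⟨u, v⟩, hp⟩ := p
    obtain ⟨x, rfl, rfl⟩ := A.mem_graph_iff.mp hp
    have h := norm_sq_add_smul hsym hc hc1 x
    rw [hf, NNReal.coe_one, one_mul]
    refine max_le (α := ℝ) (a := ‖(x : E)‖) (b := ‖A x‖) ?_ ?_ <;>
      refine (sq_le_sq₀ (norm_nonneg _) (norm_nonneg _)).mp ?_ <;> rw [h]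
    · exact le_add_of_nonneg_left (sq_nonneg _)
    · exact le_add_of_nonneg_right (sq_nonneg _)
  have hker : f.ker = ⊥ := LinearMap.ker_eq_bot.mpr hanti.injective
  have hrange : f.range = ⊤ := by
    have hclosed : IsClosed (f.range : Set E) := hanti.isClosed_range f.uniformContinuous
    have : CompleteSpace f.range := hclosed.completeSpace_coe
    rw [← Submodule.orthogonal_eq_bot_iff, Submodule.eq_bot_iff]
    intro y hy
    have hy' (x : A.domain) : inner ℂ (conj (-c) • y) (x : E) = inner ℂ y (A x) := by
      have h := Submodule.inner_left_of_mem_orthogonal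
        (LinearMap.mem_range_self f.toLinearMap ⟨(x, A x), A.mem_graph x⟩) hy
      rw [ContinuousLinearMap.coe_coe] at h
      rw [hf, inner_add_right, inner_smul_right] at h
      rw [inner_smul_left, Complex.conj_conj]
      linear_combination -h
    have hmem : y ∈ A.adjoint.domain := A.mem_adjoint_domain_of_exists y ⟨_, hy'⟩
    have hval := A.adjoint_apply_eq hA.dense_domain ⟨y, hmem⟩ hy'
    have hgraph : (y, conj (-c) • y) ∈ A.adjoint.graph := A.adjoint.mem_graph_iff.mpr ⟨_, rfl, hval⟩
    rw [LinearPMap.isSelfAdjoint_def.mp hA] at hgraph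
    obtain ⟨x, hx, hAx⟩ := A.mem_graph_iff.mp hgraph
    have hconj : conj (-c) = c := by apply Complex.ext <;> simp [hc]
    have h := norm_sq_add_smul hsym (c := -c) (by simp [hc]) (by simpa using hc1) x
    rw [hAx, hx, hconj, neg_smul, add_neg_cancel] at h
    simp only [norm_zero] at h
    exact norm_eq_zero.mp (by nlinarith [sq_nonneg ‖c • y‖, sq_nonneg ‖y‖])
  let e := ContinuousLinearEquiv.ofBijective f hker hrange
  have he (y : E) : ∃ x : A.domain, e.symm y = ⟨(x, A x), A.mem_graph x⟩ := by
    obtain ⟨x, hx, hAx⟩ := A.mem_graph_iff.mp (e.symm y).2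
    exact ⟨x, Subtype.ext (Prod.ext hx.symm hAx.symm)⟩
  let R : E →L[ℂ] E :=
    ((ContinuousLinearMap.fst ℂ E E).comp A.graph.subtypeL).comp e.symm.toContinuousLinearMap
  have hR (y : E) : ∃ x : A.domain, R y = x ∧ A x + c • (x : E) = y := by
    obtain ⟨x, hx⟩ := he y
    refine ⟨x, congrArg (fun p : A.graph => p.1.1) hx, ?_⟩
    rw [← hf, ← hx]
    exact e.apply_symm_apply y
  have hmem (y : E) : R y ∈ A.domain := by
    obtain ⟨x, hx, -⟩ := hR y
    exact hx ▸ x.2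
  refine ⟨R, hmem, fun y => ?_, fun x => ?_⟩
  · obtain ⟨x, hx, hxy⟩ := hR y
    have : (⟨R y, hmem y⟩ : A.domain) = x := Subtype.ext hx
    rw [this, hx, hxy]
  · exact congrArg (fun p : A.graph => p.1.1) (e.symm_apply_apply ⟨(x, A x), A.mem_graph x⟩)

end Resolvent

variable [CompleteSpace E]

/-- An antiunitary intertwining a normal operator with its adjoint does so for the whole
`*`-algebra generated by this operator. -/
theorem antiunitary_apply_adjoin (T : E ≃ₗᵢ⋆[ℂ] E) (R : E →L[ℂ] E) [IsStarNormal R]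
    (hTR : ∀ x, T (R x) = star R (T x)) (hTR' : ∀ x, T (star R x) = R (T x)) :
    ∀ B ∈ StarAlgebra.adjoin ℂ {R}, ∀ x, T (B x) = star B (T x) := by
  intro B hB
  have hcomm := StarAlgebra.isMulCommutative_adjoin_singleton ℂ R
  suffices (∀ x, T (B x) = star B (T x)) ∧ ∀ x, T (star B x) = B (T x) from this.1
  induction hB using StarAlgebra.adjoin_induction with
  | mem A hA => rw [Set.mem_singleton_iff.mp hA]; exact ⟨hTR, hTR'⟩
  | algebraMap r =>
    rw [← algebraMap_star_comm]
    simp [Algebra.algebraMap_eq_smul_one, T.map_smulₛₗ]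
  | add A B _ _ hA hB =>
    rw [star_add]
    exact ⟨fun x => by simp [hA.1, hB.1], fun x => by simp [hA.2, hB.2]⟩
  | mul A B hA' hB' hA hB =>
    have h : A * B = B * A := setLike_mul_comm hA' hB'
    constructor
    · intro x
      conv_rhs => rw [h, star_mul]
      simp [hA.1, hB.1]
    · intro x
      rw [star_mul]
      conv_rhs => rw [h]
      simp [hA.2, hB.2]
  | star A _ hA => rw [star_star]; exact hA.symm

/-- The commutant of a self-adjoint operator with an odd antiunitary symmetry is not abelian. -/
theorem exists_commutant_not_comm [Nontrivial E] {H : E →ₗ.[ℂ] E} (hH : IsSelfAdjoint H)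
    (T : E ≃ₗᵢ⋆[ℂ] E) (hT : ∀ x, T (T x) = -x) (hTH : CommutesWith T H) :
    ∃ P ∈ commutant H, ∃ Q ∈ commutant H, ∃ x, P (Q x) ≠ Q (P x) := by
  obtain ⟨R, hR⟩ := exists_isShiftInverse hH (c := Complex.I) Complex.I_re Complex.norm_I
  obtain ⟨R', hR'⟩ := exists_isShiftInverse hH (c := conj Complex.I) (by simp) (by simp)
  have hstar : star R = R' := hR.star_eq (isFormalAdjoint_self hH) hR'
  have hnormal : IsStarNormal R := ⟨by rw [hstar]; exact hR'.commute hR⟩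
  let S := StarAlgebra.adjoin ℂ {R}
  have hRS : R ∈ S := StarAlgebra.self_mem_adjoin_singleton ℂ R
  have hTS : ∀ B ∈ S, ∀ x, T (B x) = star B (T x) := by
    refine antiunitary_apply_adjoin T R ?_ ?_ <;> rw [hstar]
    · exact hR.antilinear_apply hR' T hTH
    · exact hR'.antilinear_apply (by rwa [Complex.conj_conj]) T hTH
  obtain ⟨v, w, x, h⟩ := exists_cyclicSubspace_starProjection_not_comm S T hT hTS
  exact ⟨_, hR.commutesWith (cyclicSubspace_starProjection_comm S v hRS), _,
    hR.commutesWith (cyclicSubspace_starProjection_comm S w hRS), x, h⟩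

end Kramers

theorem mainTheorem1 {E : Type*} [NormedAddCommGroup E] [InnerProductSpace ℂ E]
    [CompleteSpace E] [TopologicalSpace.SeparableSpace E]
    (H : E →ₗ.[ℂ] E) (hH : IsSelfAdjoint H) (hH0 : H ≠ 0)
    (T : E ≃ₗᵢ⋆[ℂ] E) (hT : ∀ x, T (T x) = -x) (hTH : Kramers.CommutesWith T H) :
    Kramers.ofBounded '' Kramers.commutant H ≠ Kramers.doubleCommutant H ∧
      Kramers.commutant H ≠ Kramers.boundedDoubleCommutant H := by
  have : Nontrivial E := by
    by_contra hE
    rw [not_nontrivial_iff_subsingleton] at hE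
    exact hH0 (LinearPMap.ext (Subsingleton.elim _ _) fun _ _ _ => Subsingleton.elim _ _)
  obtain ⟨P, hP, Q, hQ, x, hPQ⟩ := Kramers.exists_commutant_not_comm hH T hT hTH
  have hP' : P ∉ Kramers.boundedDoubleCommutant H := fun h =>
    hPQ (Kramers.apply_comm_of_mem_boundedDoubleCommutant hQ h x)
  refine ⟨fun h => hP' ?_, fun h => hP' (h ▸ hP)⟩
  have : Kramers.ofBounded P ∈ Kramers.doubleCommutant H := h ▸ Set.mem_image_of_mem _ hP
  exact this
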